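/- Let $(Y,d_Y)$ be a compact metric space and $g:Y\to Y$ a continuous surjection satisfying Wieler's axioms with constants $\beta>0$, $K\in\mathbb N^+$, $0<\gamma<1$: (1) if $d_Y(x,y)\le\beta$ then $d_Y(g^K(x),g^K(y))\le\gamma^K d_Y(g^{2K}(x),g^{2K}(y))$; (2) $g^K(B(g^K(x),\epsilon))\subseteq g^{2K}(B(x,\gamma\epsilon))$ for all $x\in Y$ and $0<\epsilon\le\beta$, where $B$ denotes open balls. Let $X=\varprojlim(Y,g)=\{\mathbf x=(x_n)_{n\ge 0}: g(x_{i+1})=x_i\}$, let $\varphi:X\to X$, $\varphi(x_0,x_1,\dots)=(g(x_0),g(x_1),\dots)$, and let $$d_X(\mathbf x,\mathbf y)=\sum_{i=0}^K\gamma^i\, d'_X(\varphi^i(\mathbf x),\varphi^i(\mathbf y)),\qquad d'_X(\mathbf x,\mathbf y)=\sup_{n}\gamma^n d_Y(x_n,y_n).$$ Assume that $(X,\varphi)$ is mixing: for all non-empty open $U,V\subseteq X$ there is $N$ with $\varphi^n(U)\cap V\ne\emptyset$ for all $n\ge N$. Let $\mathbf P\subseteq X$ be a finite $\varphi$-invariant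 set, and let $X^u(\mathbf P)$ be the set of $\mathbf x\in X$ such that $d_X(\varphi^{-n}(\mathbf x),\varphi^{-n}(\mathbf p))\to 0$ for some $\mathbf p\in\mathbf P$. For $\epsilon>0$ put $X^u(\mathbf x,\epsilon)=\{\mathbf y\in X: d_Y(x_n,y_n)<\epsilon\ \text{for all } n,\ d_X(\mathbf x,\mathbf y)<\epsilon\}$, and give $X^u(\mathbf P)$ the topology in which the sets $X^u(\mathbf x,\delta)$, $\delta>0$, form a neighborhood base at $\mathbf x$. Let $\pi_0:X^u(\mathbf P)\to Y$, $\pi_0(\mathbf x)=x_0$. Fix $K_0\ge K$ such that $d_X(\mathbf x,\mathbf y)<\beta/4$ whenever $x_i=y_i$ for all $i\le K_0$, and fix $0<\epsilon_Y<\beta/4$ such that $\varphi^{K_0}(X^u(\mathbf x,\epsilon_Y))\subseteq X^u(\varphi^{K_0}(\mathbf x),\beta/4)$ for all $\mathbf x\in X$. For $\mathbf x,\mathbf y\in X^u(\mathbf P)$ write $\mathbf x\sim_0\mathbf y$ if $\pi_0(\mathbf x)=\pi_0(\mathbf y)$ and there are $0<\delta<\epsilon_Y$ and an open set $U\subseteq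 X^u(\mathbf y,\epsilon_Y)$ of $X^u(\mathbf P)$ with $\pi_0(X^u(\mathbf x,\delta))=\pi_0(U)$. Let $q:X^u(\mathbf P)\to X^u(\mathbf P)/{\sim_0}$ be the quotient map onto the quotient space (with the quotient topology), and let $r:X^u(\mathbf P)/{\sim_0}\to Y$ be the map with $r\circ q=\pi_0$. **Theorem.** For every $y\in Y$ the set $r^{-1}(\{y\})=\{r_1,\dots,r_l\}$ is finite, and there are an open neighborhood $W$ of $y$ in $Y$, open neighborhoods $U_i$ of $r_i$ in $X^u(\mathbf P)/{\sim_0}$ $(i=1,\dots,l)$, and pairwise disjoint open sets $V_{\mathbf x}\subseteq X^u(\mathbf P)$, indexed by $\mathbf x\in\pi_0^{-1}(\{y\})$, such that 1. $r^{-1}(W)=\bigcup_{i=1}^l U_i$; 2. $\mathbf x\in V_{\mathbf x}$ for each $\mathbf x\in\pi_0^{-1}(\{y\})$; 3. $\pi_0^{-1}(W)=\bigcup_{\mathbf x\in\pi_0^{-1}(\{y\})}V_{\mathbf x}$; 4. for each $\mathbf x\in\pi_0^{-1}(\{y\})$, $q|_{V_{\mathbf x}}$ is a homeomorphism onto its image,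 and this image is $U_i$, where $q(\mathbf x)=r_i$. -/

import Mathlib

open Set Filter Topology

/-- A continuous surjection `g` of a compact metric space `Y`, together with constants
`β`, `K`, `γ` for which Wieler's two axioms hold. -/
structure WielerSystem (Y : Type*) [MetricSpace Y] where
  g : Y → Y
  continuous_g : Continuous g
  surjective_g : Function.Surjective g
  β : ℝ
  K : ℕ
  γ : ℝ
  β_pos : 0 < β
  K_pos : 0 < K
  γ_pos : 0 < γ
  γ_lt_one : γ < 1
  axiom_one : ∀ x y : Y, dist x y ≤ β →
    dist (g^[K] x) (g^[K] y) ≤ γ ^ K * dist (g^[2 * K] x) (g^[2 * K] y)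
  axiom_two : ∀ (x : Y) (ε : ℝ), 0 < ε → ε ≤ β →
    g^[K] '' Metric.ball (g^[K] x) ε ⊆ g^[2 * K] '' Metric.ball x (γ * ε)

namespace WielerSystem

variable {Y : Type*} [MetricSpace Y]

/-- The inverse limit `X` of `Y ← Y ← Y ← ⋯` along `g`. -/
def Solenoid (S : WielerSystem Y) : Type _ :=
  {x : ℕ → Y // ∀ i, S.g (x (i + 1)) = x i}

/-- The homeomorphism `φ (x₀, x₁, …) = (g x₀, g x₁, …) = (g x₀, x₀, x₁, …)`; its inverse forgets
the first coordinate. -/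
def shift (S : WielerSystem Y) : S.Solenoid ≃ S.Solenoid where
  toFun x := ⟨fun n => S.g (x.1 n), fun i => congrArg S.g (x.2 i)⟩
  invFun x := ⟨fun n => x.1 (n + 1), fun i => x.2 (i + 1)⟩
  left_inv x := Subtype.ext (funext fun n => x.2 n)
  right_inv x := Subtype.ext (funext fun n => x.2 n)

/-- `d'(x, y) = sup_n γⁿ d(xₙ, yₙ)`. -/
noncomputable def preDist (S : WielerSystem Y) (x y : S.Solenoid) : ℝ :=
  ⨆ n : ℕ, S.γ ^ n * dist (x.1 n) (y.1 n)

/-- `d_X(x, y) = ∑_{i=0}^{K} γⁱ d'(φⁱ x, φⁱ y)`. -/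
noncomputable def solenoidDist (S : WielerSystem Y) (x y : S.Solenoid) : ℝ :=
  ∑ i ∈ Finset.range (S.K + 1), S.γ ^ i * S.preDist (S.shift^[i] x) (S.shift^[i] y)

section metric

variable [CompactSpace Y] (S : WielerSystem Y)

theorem bddAbove_preDist (x y : S.Solenoid) :
    BddAbove (range fun n : ℕ => S.γ ^ n * dist (x.1 n) (y.1 n)) := by
  refine ⟨Metric.diam (univ : Set Y), ?_⟩
  rintro _ ⟨n, rfl⟩
  have h1 : dist (x.1 n) (y.1 n) ≤ Metric.diam (univ : Set Y) :=
    Metric.dist_le_diam_of_mem isCompact_univ.isBounded (mem_univ _) (mem_univ _)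
  have h2 : S.γ ^ n ≤ 1 := pow_le_one₀ S.γ_pos.le S.γ_lt_one.le
  calc S.γ ^ n * dist (x.1 n) (y.1 n) ≤ 1 * dist (x.1 n) (y.1 n) :=
        mul_le_mul_of_nonneg_right h2 dist_nonneg
    _ ≤ _ := by rw [one_mul]; exact h1

theorem le_preDist (x y : S.Solenoid) (n : ℕ) :
    S.γ ^ n * dist (x.1 n) (y.1 n) ≤ S.preDist x y :=
  le_ciSup (S.bddAbove_preDist x y) n

theorem preDist_nonneg (x y : S.Solenoid) : 0 ≤ S.preDist x y :=
  le_trans (mul_nonneg (pow_nonneg S.γ_pos.le 0) dist_nonneg) (S.le_preDist x y 0)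

theorem preDist_triangle (x y z : S.Solenoid) :
    S.preDist x z ≤ S.preDist x y + S.preDist y z := by
  refine ciSup_le fun n => ?_
  calc S.γ ^ n * dist (x.1 n) (z.1 n)
      ≤ S.γ ^ n * (dist (x.1 n) (y.1 n) + dist (y.1 n) (z.1 n)) :=
        mul_le_mul_of_nonneg_left (dist_triangle _ _ _) (pow_nonneg S.γ_pos.le n)
    _ = S.γ ^ n * dist (x.1 n) (y.1 n) + S.γ ^ n * dist (y.1 n) (z.1 n) := mul_add _ _ _
    _ ≤ _ := add_le_add (S.le_preDist x y n) (S.le_preDist y z n)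

theorem preDist_le_solenoidDist (x y : S.Solenoid) : S.preDist x y ≤ S.solenoidDist x y := by
  have h := Finset.single_le_sum
    (f := fun i => S.γ ^ i * S.preDist (S.shift^[i] x) (S.shift^[i] y))
    (fun i _ => mul_nonneg (pow_nonneg S.γ_pos.le i) (S.preDist_nonneg _ _))
    (Finset.mem_range.2 (Nat.succ_pos S.K))
  simpa [solenoidDist] using h

noncomputable instance : MetricSpace S.Solenoid where
  dist := S.solenoidDist
  dist_self x := by simp [solenoidDist, preDist]
  dist_comm x y := by simp [solenoidDist, preDist, dist_comm]
  dist_triangle x y z := by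
    rw [solenoidDist, solenoidDist, solenoidDist, ← Finset.sum_add_distrib]
    refine Finset.sum_le_sum fun i _ => ?_
    rw [← mul_add]
    exact mul_le_mul_of_nonneg_left (S.preDist_triangle _ _ _) (pow_nonneg S.γ_pos.le i)
  eq_of_dist_eq_zero := by
    intro x y h
    refine Subtype.ext (funext fun n => dist_le_zero.1 ?_)
    have h1 : S.γ ^ n * dist (x.1 n) (y.1 n) ≤ 0 :=
      ((S.le_preDist x y n).trans (S.preDist_le_solenoidDist x y)).trans (le_of_eq h)
    exact nonpos_of_mul_nonpos_right h1 (pow_pos S.γ_pos n)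

end metric

variable [CompactSpace Y]

/-- The dynamical system `(X, φ)` is mixing. -/
def IsMixing (S : WielerSystem Y) : Prop :=
  ∀ U V : Set S.Solenoid, IsOpen U → IsOpen V → U.Nonempty → V.Nonempty →
    ∃ N : ℕ, ∀ n ≥ N, ((S.shift^[n] '' U) ∩ V).Nonempty

/-- Unstable equivalence: `d_X(φ⁻ⁿ x, φ⁻ⁿ y) → 0`. -/
def UnstablyEquiv (S : WielerSystem Y) (x y : S.Solenoid) : Prop :=
  Tendsto (fun n : ℕ => dist (S.shift.symm^[n] x) (S.shift.symm^[n] y)) atTop (𝓝 0)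

/-- The local unstable set `X^u(x, ε)`. -/
def localUnstable (S : WielerSystem Y) (x : S.Solenoid) (ε : ℝ) : Set S.Solenoid :=
  {y | (∀ n, dist (x.1 n) (y.1 n) < ε) ∧ dist x y < ε}

theorem localUnstable_mono (S : WielerSystem Y) (x : S.Solenoid) {ε ε' : ℝ} (h : ε ≤ ε') :
    S.localUnstable x ε ⊆ S.localUnstable x ε' :=
  fun _ hy => ⟨fun n => (hy.1 n).trans_le h, hy.2.trans_le h⟩

/-- `K₀ ≥ K`, and points of `X` agreeing in the coordinates `0, …, K₀` are at distance
less than `β / 4`. -/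
def IsAdmissibleDepth (S : WielerSystem Y) (K₀ : ℕ) : Prop :=
  S.K ≤ K₀ ∧ ∀ x y : S.Solenoid, (∀ i ≤ K₀, x.1 i = y.1 i) → dist x y < S.β / 4

/-- `0 < ε_Y < β / 4` and `φ^{K₀}(X^u(x, ε_Y)) ⊆ X^u(φ^{K₀} x, β / 4)` for all `x` in `X`. -/
def IsAdmissibleRadius (S : WielerSystem Y) (K₀ : ℕ) (εY : ℝ) : Prop :=
  0 < εY ∧ εY < S.β / 4 ∧ ∀ x : S.Solenoid,
    S.shift^[K₀] '' S.localUnstable x εY ⊆ S.localUnstable (S.shift^[K₀] x) (S.β / 4)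

/-- The set `X^u(P)` of points unstably equivalent to a point of `P`. -/
def UnstableSpace (S : WielerSystem Y) (P : Set S.Solenoid) : Type _ :=
  {x : S.Solenoid // ∃ p ∈ P, S.UnstablyEquiv x p}

variable {S : WielerSystem Y} {P : Set S.Solenoid}

/-- `X^u(x, ε)` as a subset of `X^u(P)`, for `x` in `X^u(P)`. -/
def unstableNhd (x : S.UnstableSpace P) (ε : ℝ) : Set (S.UnstableSpace P) :=
  {z | z.1 ∈ S.localUnstable x.1 ε}

/-- The topology of `X^u(P)` for which the sets `X^u(x, δ)`, `δ > 0`, form a neighbourhood base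
at `x`. It is finer than the subspace topology inherited from `X`. -/
instance : TopologicalSpace (S.UnstableSpace P) where
  IsOpen U := ∀ x ∈ U, ∃ δ > 0, unstableNhd x δ ⊆ U
  isOpen_univ := fun _ _ => ⟨1, one_pos, subset_univ _⟩
  isOpen_inter := by
    rintro U V hU hV x ⟨hxU, hxV⟩
    obtain ⟨δ, hδ, h⟩ := hU x hxU
    obtain ⟨δ', hδ', h'⟩ := hV x hxV
    exact ⟨min δ δ', lt_min hδ hδ', fun z hz =>
      ⟨h (S.localUnstable_mono _ (min_le_left _ _) hz),
        h' (S.localUnstable_mono _ (min_le_right _ _) hz)⟩⟩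
  isOpen_sUnion := by
    rintro 𝒰 h𝒰 x ⟨U, hU, hxU⟩
    obtain ⟨δ, hδ, h⟩ := h𝒰 U hU x hxU
    exact ⟨δ, hδ, h.trans (subset_sUnion_of_mem hU)⟩

/-- `π₀ : X^u(P) → Y`, the coordinate `x₀`. -/
def π₀ (x : S.UnstableSpace P) : Y := x.1.1 0

/-- The relation `x ∼₀ y` on `X^u(P)`. -/
def Rel₀ (P : Set S.Solenoid) (εY : ℝ) (x y : S.UnstableSpace P) : Prop :=
  π₀ x = π₀ y ∧
    ∃ δ : ℝ, 0 < δ ∧ δ < εY ∧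
      ∃ U : Set (S.UnstableSpace P), IsOpen U ∧ U ⊆ unstableNhd y εY ∧
        π₀ '' unstableNhd x δ = π₀ '' U

/-- The quotient `X^u(P)/∼₀`, with the quotient topology. -/
def QuotientSpace (P : Set S.Solenoid) (εY : ℝ) : Type _ := Quot (Rel₀ P εY)

instance (εY : ℝ) : TopologicalSpace (QuotientSpace P εY) :=
  inferInstanceAs (TopologicalSpace (Quot (Rel₀ P εY)))

/-- The quotient map `q : X^u(P) → X^u(P)/∼₀`. -/
def q (P : Set S.Solenoid) (εY : ℝ) (x : S.UnstableSpace P) : QuotientSpace P εY :=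
  Quot.mk _ x

/-- The map `r : X^u(P)/∼₀ → Y`, `[x] ↦ x₀`. -/
def r (P : Set S.Solenoid) (εY : ℝ) : QuotientSpace P εY → Y :=
  Quot.lift π₀ fun _ _ h => h.1

end WielerSystem

/-! Attach to x the filter `germ x` of images under π₀ of neighbourhoods of x. Axiom one makes π₀ an
embedding on sets whose points stay β-close in every coordinate (`eq_of_coord_zero_eq`,
`germ_eq_nhdsWithin`). Hence `germ x` is the germ at x₀ of the set π₀(X^u(x, β/2)), and x ∼₀ z turns
out to mean `germ x = germ z` (`q_eq_iff`). Equality of germs persists at nearby points, so q is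
open (`isOpenMap_q`); being injective on small sets, it is a local homeomorphism.

Axiom two supplies finiteness and uniformity: every g^K(w) with w within a fixed ε of x_K lifts to
X^u(x, β/2) (`exists_lift_localUnstable`). Over y the germ of x therefore depends on x_K only up to
ε, and total boundedness of Y leaves finitely many germs. The fibre of π₀ may be infinite, yet the
same finite net yields one W for all of it (`eventually_mem_image_of_germ_eq`), and V_x is the part
of X^u(x, β/2) over W. -/

namespace WielerSystem

/-! ### Backward contraction of coordinates -/

section coordinates

variable {Y : Type*} [MetricSpace Y] (S : WielerSystem Y)

theorem iterate_coord (x : S.Solenoid) (i n : ℕ) : S.g^[i] (x.1 (n + i)) = x.1 n := by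
  induction i generalizing n with
  | zero => rfl
  | succ i ih =>
    rw [Function.iterate_succ_apply, ← add_assoc, x.2, ih]

theorem shift_iterate_coord (x : S.Solenoid) (i n : ℕ) :
    (S.shift^[i] x).1 n = S.g^[i] (x.1 n) := by
  induction i generalizing x with
  | zero => rfl
  | succ i ih =>
    rw [Function.iterate_succ_apply, ih, Function.iterate_succ_apply]
    rfl

theorem shift_symm_iterate_coord (x : S.Solenoid) (i n : ℕ) :
    (S.shift.symm^[i] x).1 n = x.1 (n + i) := by
  induction i generalizing x with
  | zero => rfl
  | succ i ih =>
    rw [Function.iterate_succ_apply, ih]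
    rfl

/-- Backward contraction along orbits which stay `β`-close. -/
theorem dist_coord_add_le {x z : S.Solenoid} (h : ∀ n, dist (x.1 n) (z.1 n) ≤ S.β) (n : ℕ) :
    dist (x.1 (n + S.K)) (z.1 (n + S.K)) ≤ S.γ ^ S.K * dist (x.1 n) (z.1 n) := by
  -- Axiom one is applied to the coordinates n + 2K, which g^K takes to n + K and g^{2K} to n.
  have h1 := S.axiom_one _ _ (h (n + S.K + S.K))
  rw [S.iterate_coord, S.iterate_coord] at h1
  have h2 : n + S.K + S.K = n + 2 * S.K := by ring
  rwa [h2, S.iterate_coord, S.iterate_coord] at h1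

theorem dist_coord_add_le_self {x z : S.Solenoid} (h : ∀ n, dist (x.1 n) (z.1 n) ≤ S.β) (n : ℕ) :
    dist (x.1 (n + S.K)) (z.1 (n + S.K)) ≤ dist (x.1 n) (z.1 n) :=
  (S.dist_coord_add_le h n).trans
    (mul_le_of_le_one_left dist_nonneg (pow_le_one₀ S.γ_pos.le S.γ_lt_one.le))

theorem dist_coord_add_mul_le {x z : S.Solenoid} (h : ∀ n, dist (x.1 n) (z.1 n) ≤ S.β)
    (n j : ℕ) :
    dist (x.1 (n + j * S.K)) (z.1 (n + j * S.K)) ≤ (S.γ ^ S.K) ^ j * dist (x.1 n) (z.1 n) := by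
  induction j with
  | zero => simp
  | succ j ih =>
    have h1 := S.dist_coord_add_le h (n + j * S.K)
    rw [show n + (j + 1) * S.K = n + j * S.K + S.K by ring, pow_succ', mul_assoc]
    exact h1.trans (mul_le_mul_of_nonneg_left ih (pow_nonneg S.γ_pos.le _))

theorem dist_coord_mul_le {x z : S.Solenoid} (h : ∀ n, dist (x.1 n) (z.1 n) ≤ S.β) (j : ℕ) :
    dist (x.1 (j * S.K)) (z.1 (j * S.K)) ≤ dist (x.1 0) (z.1 0) := by
  have h1 := S.dist_coord_add_mul_le h 0 j
  rw [zero_add] at h1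
  exact h1.trans (mul_le_of_le_one_left dist_nonneg
    (pow_le_one₀ (pow_nonneg S.γ_pos.le _) (pow_le_one₀ S.γ_pos.le S.γ_lt_one.le)))

/-- Points of the solenoid with `β`-close coordinates are determined by the coordinate `0`. -/
theorem eq_of_coord_zero_eq {x z : S.Solenoid} (h : ∀ n, dist (x.1 n) (z.1 n) ≤ S.β)
    (h0 : x.1 0 = z.1 0) : x = z := by
  refine Subtype.ext (funext fun n => ?_)
  have h1 : x.1 (n * S.K) = z.1 (n * S.K) :=
    dist_le_zero.1 ((S.dist_coord_mul_le h n).trans (by rw [h0, dist_self]))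
  -- Only multiples of K are controlled so far; coordinate n is the image of coordinate nK ≥ n under
  -- an iterate of g.
  obtain ⟨t, ht⟩ := Nat.exists_eq_add_of_le (Nat.le_mul_of_pos_right n S.K_pos)
  rw [ht] at h1
  rw [← S.iterate_coord x t n, ← S.iterate_coord z t n, h1]

/-- If two orbits stay `β`-close, their distance is attained in the first `K` coordinates. -/
theorem exists_dist_coord_le {x z : S.Solenoid} (h : ∀ n, dist (x.1 n) (z.1 n) ≤ S.β) :
    ∃ m, ∀ n, dist (x.1 n) (z.1 n) ≤ dist (x.1 m) (z.1 m) := by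
  obtain ⟨m, -, hm⟩ := Finset.exists_max_image (Finset.range S.K)
    (fun n => dist (x.1 n) (z.1 n)) ⟨0, Finset.mem_range.2 S.K_pos⟩
  refine ⟨m, fun n => ?_⟩
  induction n using Nat.strong_induction_on with
  | _ n ih =>
    by_cases hn : n < S.K
    · exact hm n (Finset.mem_range.2 hn)
    · obtain ⟨t, rfl⟩ := Nat.exists_eq_add_of_le' (not_lt.1 hn)
      exact (S.dist_coord_add_le_self h t).trans (ih t (by have := S.K_pos; omega))

theorem tendsto_dist_coord {x z : S.Solenoid} (h : ∀ n, dist (x.1 n) (z.1 n) ≤ S.β) :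
    Tendsto (fun n => dist (x.1 n) (z.1 n)) atTop (𝓝 0) := by
  have hc : S.γ ^ S.K < 1 := pow_lt_one₀ S.γ_pos.le S.γ_lt_one S.K_pos.ne'
  have hb (n : ℕ) : dist (x.1 n) (z.1 n) ≤ (S.γ ^ S.K) ^ (n / S.K) * S.β := by
    have h1 := S.dist_coord_add_mul_le h (n % S.K) (n / S.K)
    rw [Nat.mod_add_div'] at h1
    exact h1.trans (mul_le_mul_of_nonneg_left (h _) (pow_nonneg (pow_nonneg S.γ_pos.le _) _))
  have ht : Tendsto (fun n : ℕ => (S.γ ^ S.K) ^ (n / S.K) * S.β) atTop (𝓝 0) := by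
    have := ((tendsto_pow_atTop_nhds_zero_of_lt_one (pow_nonneg S.γ_pos.le _) hc).comp
      (Nat.tendsto_div_const_atTop S.K_pos.ne')).mul_const S.β
    simpa using this
  exact squeeze_zero (fun _ => dist_nonneg) hb ht

end coordinates

/-! ### Uniform estimates and lifting to local unstable sets -/

section compact

variable {Y : Type*} [MetricSpace Y] [CompactSpace Y] (S : WielerSystem Y)

theorem dist_solenoid_le {x z : S.Solenoid} {s : ℝ}
    (h : ∀ i ≤ S.K, ∀ n, dist (S.g^[i] (x.1 n)) (S.g^[i] (z.1 n)) ≤ s) :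
    dist x z ≤ (S.K + 1) * s := by
  have hs : 0 ≤ s := dist_nonneg.trans (h 0 (Nat.zero_le _) 0)
  have hpow (i : ℕ) : S.γ ^ i ≤ 1 := pow_le_one₀ S.γ_pos.le S.γ_lt_one.le
  have h1 : dist x z ≤ ∑ _i ∈ Finset.range (S.K + 1), s := by
    change S.solenoidDist x z ≤ _
    refine Finset.sum_le_sum fun i hi => ?_
    have hd : S.preDist (S.shift^[i] x) (S.shift^[i] z) ≤ s := by
      refine ciSup_le fun n => ?_
      rw [S.shift_iterate_coord, S.shift_iterate_coord]
      exact (mul_le_of_le_one_left dist_nonneg (hpow n)).trans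
        (h i (Nat.lt_succ_iff.1 (Finset.mem_range.1 hi)) n)
    exact (mul_le_of_le_one_left (S.preDist_nonneg _ _) (hpow i)).trans hd
  simpa using h1

theorem exists_modulus (M : ℕ) {δ : ℝ} (hδ : 0 < δ) :
    ∃ η > 0, ∀ i ≤ M, ∀ a b : Y, dist a b < η → dist (S.g^[i] a) (S.g^[i] b) < δ := by
  induction M with
  | zero =>
    refine ⟨δ, hδ, fun i hi a b hab => ?_⟩
    rwa [Nat.le_zero.1 hi]
  | succ M ih =>
    obtain ⟨η, hη, h⟩ := ih
    obtain ⟨η', hη', h'⟩ := Metric.uniformContinuous_iff.1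
      (CompactSpace.uniformContinuous_of_continuous (S.continuous_g.iterate (M + 1))) δ hδ
    refine ⟨min η η', lt_min hη hη', fun i hi a b hab => ?_⟩
    rcases Nat.lt_or_ge M i with hM | hM
    · obtain rfl : i = M + 1 := by omega
      exact h' (hab.trans_le (min_le_right _ _))
    · exact h i hM a b (hab.trans_le (min_le_left _ _))

theorem mem_localUnstable_comm {x z : S.Solenoid} {δ : ℝ} :
    z ∈ S.localUnstable x δ ↔ x ∈ S.localUnstable z δ := by
  simp only [localUnstable, mem_ofPred_eq, dist_comm]

/-- Closeness in the coordinates divisible by `K` forces closeness in the unstable topology. -/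
theorem exists_mem_localUnstable_of_dist_mul_lt {δ : ℝ} (hδ : 0 < δ) :
    ∃ η > 0, ∀ x z : S.Solenoid, (∀ j, dist (x.1 (j * S.K)) (z.1 (j * S.K)) < η) →
      z ∈ S.localUnstable x δ := by
  have hK : (0 : ℝ) < S.K + 2 := by positivity
  have hs : 0 < δ / (S.K + 2) := by positivity
  obtain ⟨η, hη, h⟩ := S.exists_modulus (2 * S.K) hs
  refine ⟨η, hη, fun x z hxz => ?_⟩
  have key : ∀ i ≤ S.K, ∀ n, dist (S.g^[i] (x.1 n)) (S.g^[i] (z.1 n)) < δ / (S.K + 2) := by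
    intro i hi n
    have hmod := Nat.mod_add_div' n S.K
    have hlt := Nat.mod_lt n S.K_pos
    -- The next multiple of K lies at most K beyond n; with i ≤ K, at most 2K applications of g lead
    -- back from it, hence the modulus for 2K.
    have hn : (n / S.K + 1) * S.K = n + (S.K - n % S.K) := by
      rw [add_mul, one_mul]; omega
    have h1 := h (i + (S.K - n % S.K)) (by omega) _ _ (hxz (n / S.K + 1))
    rwa [hn, Function.iterate_add_apply, Function.iterate_add_apply, S.iterate_coord,
      S.iterate_coord] at h1
  refine ⟨fun n => (key 0 (Nat.zero_le _) n).trans_le ?_, ?_⟩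
  · exact div_le_self hδ.le (by have := Nat.cast_nonneg (α := ℝ) S.K; linarith)
  · calc dist x z ≤ (S.K + 1) * (δ / (S.K + 2)) :=
          S.dist_solenoid_le fun i hi n => (key i hi n).le
      _ < (S.K + 2) * (δ / (S.K + 2)) := mul_lt_mul_of_pos_right (by linarith) hs
      _ = δ := mul_div_cancel₀ _ hK.ne'

/-- Among `β`-close orbits, the coordinate `0` controls the unstable topology, uniformly. -/
theorem exists_mem_localUnstable_of_dist_zero_lt {δ : ℝ} (hδ : 0 < δ) :
    ∃ η > 0, ∀ x z : S.Solenoid, (∀ n, dist (x.1 n) (z.1 n) ≤ S.β) →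
      dist (x.1 0) (z.1 0) < η → z ∈ S.localUnstable x δ := by
  obtain ⟨η, hη, h⟩ := S.exists_mem_localUnstable_of_dist_mul_lt hδ
  exact ⟨η, hη, fun x z hxz h0 => h x z fun j => (S.dist_coord_mul_le hxz j).trans_lt h0⟩

/-- The `g^K`-image of a small ball about `x_K` lifts to the local unstable set of `x`. -/
theorem exists_lift_localUnstable {δ : ℝ} (hδ : 0 < δ) :
    ∃ ε > 0, ∀ (x : S.Solenoid) (w : Y), dist w (x.1 S.K) < ε →
      ∃ v ∈ S.localUnstable x δ, v.1 0 = S.g^[S.K] w := by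
  obtain ⟨η, hη, hctl⟩ := S.exists_mem_localUnstable_of_dist_mul_lt hδ
  obtain ⟨ε', hε', hmod⟩ := S.exists_modulus S.K hη
  have hε : 0 < min ε' S.β := lt_min hε' S.β_pos
  refine ⟨min ε' S.β, hε, fun x w hw => ?_⟩
  -- Axiom two moves K coordinates further back. It gives g^{2K} b = g^K a, not g^K b = a, so the
  -- lift is read off after an extra g^K.
  have step : ∀ (j : ℕ) (a : Y), dist a (x.1 ((j + 1) * S.K)) < min ε' S.β →
      ∃ b, dist b (x.1 ((j + 1 + 1) * S.K)) < min ε' S.β ∧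
        S.g^[2 * S.K] b = S.g^[S.K] a := by
    intro j a ha
    have hx : S.g^[S.K] (x.1 ((j + 1 + 1) * S.K)) = x.1 ((j + 1) * S.K) := by
      rw [add_mul (j + 1) 1, one_mul, S.iterate_coord]
    obtain ⟨b, hb, hba⟩ := S.axiom_two (x.1 ((j + 1 + 1) * S.K)) _ hε (min_le_right _ _)
      (mem_image_of_mem _ (show a ∈ Metric.ball (S.g^[S.K] _) _ by rwa [hx]))
    exact ⟨b, lt_of_lt_of_le hb (mul_le_of_le_one_left hε.le S.γ_lt_one.le), hba⟩
  choose! f hf hfg using step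
  let u : ℕ → Y := fun j => Nat.rec w f j
  have hu (j : ℕ) : dist (u j) (x.1 ((j + 1) * S.K)) < min ε' S.β := by
    induction j with
    | zero => simpa [u] using hw
    | succ j ih => exact hf j (u j) ih
  have hug (j : ℕ) : S.g^[2 * S.K] (u (j + 1)) = S.g^[S.K] (u j) := hfg j (u j) (hu j)
  have hui (j i : ℕ) : S.g^[i * S.K + S.K] (u (j + i)) = S.g^[S.K] (u j) := by
    induction i with
    | zero => simp
    | succ i ih =>
      rw [show (i + 1) * S.K + S.K = i * S.K + 2 * S.K by ring, ← add_assoc j,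
        Function.iterate_add_apply, hug, ← Function.iterate_add_apply, ih]
  have hle (n : ℕ) : n ≤ n * S.K := Nat.le_mul_of_pos_right n S.K_pos
  -- The point u_n is near x_{(n+1)K}, and g^K(u_n) is to be coordinate nK of the lift; g^{nK-n}
  -- brings it to coordinate n.
  let v : S.Solenoid := ⟨fun n => S.g^[n * S.K - n + S.K] (u n), fun n => by
    have h1 := hle n
    have h2 : ((n + 1) * S.K - (n + 1) + S.K) + 1 = n * S.K - n + 2 * S.K := by
      have := S.K_pos
      rw [add_mul, one_mul]; omega
    rw [← Function.iterate_succ_apply' S.g, Nat.succ_eq_add_one, h2,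
      Function.iterate_add_apply, hug, ← Function.iterate_add_apply]⟩
  have hv (j : ℕ) : v.1 (j * S.K) = S.g^[S.K] (u j) := by
    obtain ⟨i, hi⟩ := Nat.exists_eq_add_of_le (hle j)
    have h1 : j * S.K * S.K - j * S.K + S.K = i * S.K + S.K := by
      rw [hi, add_mul, ← hi]; omega
    change S.g^[j * S.K * S.K - j * S.K + S.K] (u (j * S.K)) = _
    rw [h1, hi, hui]
  refine ⟨v, hctl x v fun j => ?_, ?_⟩
  · have h1 := hmod S.K le_rfl _ _ ((hu j).trans_le (min_le_left _ _))
    rw [add_mul, one_mul, S.iterate_coord] at h1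
    rwa [hv, dist_comm]
  · have h1 := hv 0
    rwa [zero_mul] at h1

theorem unstablyEquiv_of_dist_coord_le {x z : S.Solenoid}
    (h : ∀ n, dist (x.1 n) (z.1 n) ≤ S.β) : S.UnstablyEquiv x z := by
  rw [UnstablyEquiv, Metric.tendsto_atTop]
  intro ε hε
  have hK : (0 : ℝ) < S.K + 2 := by positivity
  have hs : 0 < ε / (S.K + 2) := by positivity
  obtain ⟨N, hN⟩ := Metric.tendsto_atTop.1 (S.tendsto_dist_coord h) _ hs
  refine ⟨N + S.K, fun n hn => ?_⟩
  rw [Real.dist_0_eq_abs, abs_of_nonneg dist_nonneg]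
  have h1 : dist (S.shift.symm^[n] x) (S.shift.symm^[n] z) ≤ (S.K + 1) * (ε / (S.K + 2)) := by
    refine S.dist_solenoid_le fun i hi k => ?_
    -- The i ≤ K forward shifts in the metric undo i of the n backward ones, hence the margin in N +
    -- K.
    have hk : k + n = (k + n - i) + i := by omega
    rw [S.shift_symm_iterate_coord, S.shift_symm_iterate_coord, hk, S.iterate_coord,
      S.iterate_coord]
    have := hN (k + n - i) (by omega)
    rw [Real.dist_0_eq_abs, abs_of_nonneg dist_nonneg] at this
    exact this.le
  calc _ ≤ (S.K + 1) * (ε / (S.K + 2)) := h1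
    _ < (S.K + 2) * (ε / (S.K + 2)) := mul_lt_mul_of_pos_right (by linarith) hs
    _ = ε := mul_div_cancel₀ _ hK.ne'

theorem UnstablyEquiv.trans {S : WielerSystem Y} {x y z : S.Solenoid} (h : S.UnstablyEquiv x y)
    (h' : S.UnstablyEquiv y z) : S.UnstablyEquiv x z := by
  have := Tendsto.add h h'
  rw [add_zero] at this
  exact squeeze_zero (fun _ => dist_nonneg) (fun _ => dist_triangle _ _ _) this

end compact

/-! ### The unstable topology, germs, and the quotient map -/

section unstableSpace

variable {Y : Type*} [MetricSpace Y] [CompactSpace Y] {S : WielerSystem Y} {P : Set S.Solenoid}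

theorem mem_unstableNhd_self (x : S.UnstableSpace P) {δ : ℝ} (hδ : 0 < δ) :
    x ∈ unstableNhd x δ :=
  ⟨fun n => by rwa [dist_self], by rwa [dist_self]⟩

theorem mem_unstableNhd_comm {x z : S.UnstableSpace P} {δ : ℝ} :
    z ∈ unstableNhd x δ ↔ x ∈ unstableNhd z δ :=
  S.mem_localUnstable_comm

theorem unstableNhd_mono (x : S.UnstableSpace P) {δ δ' : ℝ} (h : δ ≤ δ') :
    unstableNhd x δ ⊆ unstableNhd x δ' :=
  fun _ hz => S.localUnstable_mono _ h hz

/-- The defining strict inequalities are infinitely many, but for δ ≤ β the largest coordinate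
distance is attained, which leaves positive slack. -/
theorem isOpen_unstableNhd (x : S.UnstableSpace P) {δ : ℝ} (hδ : δ ≤ S.β) :
    IsOpen (unstableNhd x δ) := by
  rintro z ⟨hz, hz'⟩
  obtain ⟨m, hm⟩ := S.exists_dist_coord_le fun n => (hz n).le.trans hδ
  refine ⟨min (δ - dist (x.1.1 m) (z.1.1 m)) (δ - dist x.1 z.1),
    lt_min (sub_pos.2 (hz m)) (sub_pos.2 hz'), fun u hu => ⟨fun n => ?_, ?_⟩⟩
  · have h1 := (hu.1 n).trans_le (min_le_left _ _)
    have h2 := dist_triangle (x.1.1 n) (z.1.1 n) (u.1.1 n)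
    linarith [hm n]
  · have h1 := hu.2.trans_le (min_le_right _ _)
    have h2 := dist_triangle x.1 z.1 u.1
    linarith

theorem unstableNhd_mem_nhds (x : S.UnstableSpace P) {δ : ℝ} (hδ : 0 < δ) :
    unstableNhd x δ ∈ 𝓝 x :=
  mem_of_superset ((isOpen_unstableNhd x (min_le_right δ S.β)).mem_nhds
    (mem_unstableNhd_self x (lt_min hδ S.β_pos))) (unstableNhd_mono x (min_le_left _ _))

theorem mem_nhds_unstableSpace_iff {x : S.UnstableSpace P} {A : Set (S.UnstableSpace P)} :
    A ∈ 𝓝 x ↔ ∃ δ > 0, unstableNhd x δ ⊆ A := by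
  refine ⟨fun h => ?_, fun ⟨δ, hδ, h⟩ => mem_of_superset (unstableNhd_mem_nhds x hδ) h⟩
  obtain ⟨U, hUA, hU, hxU⟩ := mem_nhds_iff.1 h
  obtain ⟨δ, hδ, h'⟩ := hU x hxU
  exact ⟨δ, hδ, h'.trans hUA⟩

theorem continuous_coord (n : ℕ) : Continuous fun x : S.UnstableSpace P => x.1.1 n := by
  refine continuous_iff_continuousAt.2 fun x => Metric.tendsto_nhds.2 fun ε hε => ?_
  filter_upwards [unstableNhd_mem_nhds x hε] with z hz
  rw [dist_comm]
  exact hz.1 n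

theorem continuous_π₀ : Continuous (π₀ : S.UnstableSpace P → Y) :=
  continuous_coord 0

theorem iterate_coord_K (x : S.UnstableSpace P) : S.g^[S.K] (x.1.1 S.K) = π₀ x := by
  have := S.iterate_coord x.1 S.K 0
  rwa [zero_add] at this

/-- A point of the solenoid in a small local unstable set of a point of `X^u(P)` is
in `X^u(P)`. -/
theorem exists_unstableSpace_eq {x : S.UnstableSpace P} {v : S.Solenoid} {δ : ℝ}
    (hδ : δ ≤ S.β) (hv : v ∈ S.localUnstable x.1 δ) : ∃ z : S.UnstableSpace P, z.1 = v := by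
  obtain ⟨p, hp, hxp⟩ := x.2
  exact ⟨⟨v, p, hp, (S.unstablyEquiv_of_dist_coord_le fun n => by
    rw [dist_comm]; exact (hv.1 n).le.trans hδ).trans hxp⟩, rfl⟩

theorem exists_lift_unstableNhd (P : Set S.Solenoid) {δ : ℝ} (hδ : 0 < δ) (hδβ : δ ≤ S.β) :
    ∃ ε > 0, ∀ (x : S.UnstableSpace P) (w : Y), dist w (x.1.1 S.K) < ε →
      ∃ v ∈ unstableNhd x δ, π₀ v = S.g^[S.K] w := by
  obtain ⟨ε, hε, h⟩ := S.exists_lift_localUnstable hδ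
  refine ⟨ε, hε, fun x w hw => ?_⟩
  obtain ⟨v, hv, hv0⟩ := h x.1 w hw
  obtain ⟨z, rfl⟩ := exists_unstableSpace_eq hδβ hv
  exact ⟨z, hv, hv0⟩

/-- Sets whose points have pairwise `β`-close coordinates. -/
def IsUnstablySmall (N : Set (S.UnstableSpace P)) : Prop :=
  ∀ x ∈ N, ∀ z ∈ N, ∀ n, dist (x.1.1 n) (z.1.1 n) ≤ S.β

theorem IsUnstablySmall.mono {M N : Set (S.UnstableSpace P)} (hN : IsUnstablySmall N)
    (h : M ⊆ N) : IsUnstablySmall M :=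
  fun x hx z hz => hN x (h hx) z (h hz)

theorem isUnstablySmall_unstableNhd (x : S.UnstableSpace P) {δ : ℝ} (hδ : δ ≤ S.β / 2) :
    IsUnstablySmall (unstableNhd x δ) := fun a ha b hb n => by
  linarith [dist_triangle_left (a.1.1 n) (b.1.1 n) (x.1.1 n), ha.1 n, hb.1 n]

theorem IsUnstablySmall.injOn {N : Set (S.UnstableSpace P)} (hN : IsUnstablySmall N) :
    InjOn π₀ N := fun x hx z hz h =>
  Subtype.ext (S.eq_of_coord_zero_eq (hN x hx z hz) h)

/-- The filter of images under `π₀` of neighbourhoods of `x`. -/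
def germ (x : S.UnstableSpace P) : Filter Y := map π₀ (𝓝 x)

instance (x : S.UnstableSpace P) : (germ x).NeBot := inferInstanceAs (map π₀ (𝓝 x)).NeBot

theorem germ_le_nhds (x : S.UnstableSpace P) : germ x ≤ 𝓝 (π₀ x) := continuous_π₀.tendsto x

theorem image_mem_germ {x : S.UnstableSpace P} {N : Set (S.UnstableSpace P)} (h : N ∈ 𝓝 x) :
    π₀ '' N ∈ germ x :=
  image_mem_map h

theorem π₀_eq_of_germ_eq {x z : S.UnstableSpace P} (h : germ x = germ z) : π₀ x = π₀ z :=
  tendsto_nhds_unique (tendsto_id'.2 (germ_le_nhds x)) (tendsto_id'.2 (h ▸ germ_le_nhds z))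

/-- On N the coordinate 0 controls the unstable topology, so a single subset of Y encodes the germs
at all points of N. -/
theorem germ_eq_nhdsWithin {N : Set (S.UnstableSpace P)} (hN : IsUnstablySmall N)
    (hN' : IsOpen N) {z : S.UnstableSpace P} (hz : z ∈ N) : germ z = 𝓝[π₀ '' N] (π₀ z) := by
  refine le_antisymm (le_inf (germ_le_nhds z)
    (le_principal_iff.2 (image_mem_germ (hN'.mem_nhds hz)))) fun A hA => ?_
  obtain ⟨δ, hδ, h⟩ := mem_nhds_unstableSpace_iff.1 hA
  obtain ⟨η, hη, hη'⟩ := S.exists_mem_localUnstable_of_dist_zero_lt hδ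
  refine Metric.mem_nhdsWithin_iff.2 ⟨η, hη, ?_⟩
  rintro _ ⟨hu, u, huN, rfl⟩
  exact h (hη' z.1 u.1 (hN z hz u huN) (by rw [dist_comm]; exact hu))

theorem germ_eq_nhdsWithin_unstableNhd (z : S.UnstableSpace P) :
    germ z = 𝓝[π₀ '' unstableNhd z (S.β / 2)] (π₀ z) :=
  germ_eq_nhdsWithin (isUnstablySmall_unstableNhd z le_rfl)
    (isOpen_unstableNhd z (half_le_self S.β_pos.le))
    (mem_unstableNhd_self z (half_pos S.β_pos))

/-- The points with the same germ as some point of `O`. -/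
def germSaturation (O : Set (S.UnstableSpace P)) : Set (S.UnstableSpace P) :=
  {z | ∃ o ∈ O, germ z = germ o}

/-- Equal germs at z and o mean that the images of small neighbourhoods agree near the base point.
They then also agree near every nearby base point, so points close to z find partners close to o. -/
theorem isOpen_germSaturation {O : Set (S.UnstableSpace P)} (hO : IsOpen O) :
    IsOpen (germSaturation O) := by
  rw [isOpen_iff_eventually]
  rintro z ⟨o, ho, hzo⟩
  have hβ := half_pos S.β_pos
  set M := O ∩ unstableNhd o (S.β / 2)
  have hM : IsOpen M := hO.inter (isOpen_unstableNhd o (half_le_self S.β_pos.le))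
  have hoM : o ∈ M := ⟨ho, mem_unstableNhd_self o hβ⟩
  have hMs : IsUnstablySmall M := (isUnstablySmall_unstableNhd o le_rfl).mono inter_subset_right
  set N := unstableNhd z (S.β / 2)
  have hN : IsOpen N := isOpen_unstableNhd z (half_le_self S.β_pos.le)
  have hNs : IsUnstablySmall N := isUnstablySmall_unstableNhd z le_rfl
  have hzN : z ∈ N := mem_unstableNhd_self z hβ
  have h0 : 𝓝[π₀ '' N] (π₀ z) = 𝓝[π₀ '' M] (π₀ z) := by
    rw [← germ_eq_nhdsWithin hNs hN hzN, hzo, π₀_eq_of_germ_eq hzo,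
      ← germ_eq_nhdsWithin hMs hM hoM]
  have h1 : ∀ᶠ t in 𝓝 (π₀ z), 𝓝[π₀ '' N] t = 𝓝[π₀ '' M] t := by
    rw [nhdsWithin_eq_iff_eventuallyEq] at h0
    filter_upwards [eventually_eventually_nhds.2 h0] with t ht
    rwa [nhdsWithin_eq_iff_eventuallyEq]
  have h2 : π₀ '' M ∈ germ z := hzo ▸ image_mem_germ (hM.mem_nhds hoM)
  filter_upwards [hN.mem_nhds hzN, continuous_π₀.continuousAt.eventually h1, h2]
    with u huN hu ⟨o', ho', hou⟩
  refine ⟨o', ho'.1, ?_⟩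
  rw [germ_eq_nhdsWithin hNs hN huN, hu, germ_eq_nhdsWithin hMs hM ho', hou]

theorem germ_eq_of_rel₀ {εY : ℝ} (hε : εY ≤ S.β / 2) {x z : S.UnstableSpace P}
    (h : Rel₀ P εY x z) : germ x = germ z := by
  obtain ⟨hxz, δ, hδ, hδε, U, hU, hUz, hπ⟩ := h
  have hβ := half_le_self S.β_pos.le
  have hUs : IsUnstablySmall U := (isUnstablySmall_unstableNhd z hε).mono hUz
  -- Some point of U lies over π₀ z, and injectivity of π₀ on X^u(z, εY) forces it to be z.
  have hzU : z ∈ U := by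
    obtain ⟨u, hu, hux⟩ : π₀ x ∈ π₀ '' U := hπ ▸ mem_image_of_mem _ (mem_unstableNhd_self x hδ)
    rwa [← (isUnstablySmall_unstableNhd z hε).injOn (hUz hu)
      (mem_unstableNhd_self z (hδ.trans hδε)) (hux.trans hxz)]
  rw [germ_eq_nhdsWithin (isUnstablySmall_unstableNhd x (hδε.le.trans hε))
    (isOpen_unstableNhd x ((hδε.le.trans hε).trans hβ)) (mem_unstableNhd_self x hδ),
    germ_eq_nhdsWithin hUs hU hzU, hπ, hxz]

/-- The open set U consists of the points of X^u(z, εY) sharing a germ with a point of X^u(x, δ);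
for small δ every point of X^u(x, δ) has such a partner. -/
theorem rel₀_of_germ_eq {εY : ℝ} (hε : 0 < εY) (hε' : εY ≤ S.β) {x z : S.UnstableSpace P}
    (h : germ x = germ z) : Rel₀ P εY x z := by
  refine ⟨π₀_eq_of_germ_eq h, ?_⟩
  obtain ⟨δ', hδ', hsub⟩ := mem_nhds_unstableSpace_iff.1
    ((isOpen_germSaturation (isOpen_unstableNhd z hε')).mem_nhds
      ⟨z, mem_unstableNhd_self z hε, h⟩)
  have hδ : min δ' (εY / 2) ≤ εY / 2 := min_le_right _ _
  refine ⟨min δ' (εY / 2), lt_min hδ' (half_pos hε), by linarith,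
    unstableNhd z εY ∩ germSaturation (unstableNhd x (min δ' (εY / 2))),
    (isOpen_unstableNhd z hε').inter (isOpen_germSaturation (isOpen_unstableNhd x (by linarith))),
    inter_subset_left, Subset.antisymm ?_ ?_⟩
  · rintro _ ⟨a, ha, rfl⟩
    obtain ⟨u, hu, hau⟩ := hsub (unstableNhd_mono x (min_le_left _ _) ha)
    exact ⟨u, ⟨hu, a, ha, hau.symm⟩, (π₀_eq_of_germ_eq hau).symm⟩
  · rintro _ ⟨u, ⟨-, a, ha, hua⟩, rfl⟩
    exact ⟨a, ha, (π₀_eq_of_germ_eq hua).symm⟩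

/-- `Quot` identifies along the generated equivalence; `germ` is constant along ∼₀, so it descends
and separates the classes. -/
theorem q_eq_iff {εY : ℝ} (hε : 0 < εY) (hε' : εY ≤ S.β / 2) {x z : S.UnstableSpace P} :
    q P εY x = q P εY z ↔ germ x = germ z := by
  refine ⟨fun h => ?_, fun h => Quot.sound
    (rel₀_of_germ_eq hε (hε'.trans (half_le_self S.β_pos.le)) h)⟩
  exact congrArg (Quot.lift germ fun _ _ => germ_eq_of_rel₀ hε') h

theorem continuous_q (P : Set S.Solenoid) (εY : ℝ) : Continuous (q P εY) := continuous_quot_mk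

theorem surjective_q (P : Set S.Solenoid) (εY : ℝ) : Function.Surjective (q P εY) :=
  Quot.mk_surjective

theorem isOpenMap_q (P : Set S.Solenoid) {εY : ℝ} (hε : 0 < εY) (hε' : εY ≤ S.β / 2) :
    IsOpenMap (q P εY) := by
  intro O hO
  have h : q P εY ⁻¹' (q P εY '' O) = germSaturation O := by
    ext z
    refine exists_congr fun o => and_congr_right fun _ => ?_
    rw [eq_comm, q_eq_iff hε hε']
  exact isOpen_coinduced.2 (h ▸ isOpen_germSaturation hO)

theorem isEmbedding_q_restrict {εY : ℝ} (hε : 0 < εY) (hε' : εY ≤ S.β / 2)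
    {N : Set (S.UnstableSpace P)} (hN : IsUnstablySmall N) (hN' : IsOpen N) :
    IsEmbedding fun z : N => q P εY z.1 := by
  refine (IsOpenEmbedding.of_continuous_injective_isOpenMap
    ((continuous_q P εY).comp continuous_subtype_val) (fun a b hab => ?_)
    ((isOpenMap_q P hε hε').comp hN'.isOpenMap_subtype_val)).isEmbedding
  exact Subtype.ext (hN.injOn a.2 b.2 (π₀_eq_of_germ_eq ((q_eq_iff hε hε').1 hab)))

end unstableSpace

/-! ### Finiteness and uniformity over a fibre -/

section fibre

variable {Y : Type*} [MetricSpace Y] [CompactSpace Y] {S : WielerSystem Y} {P : Set S.Solenoid}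

/-- The constant `ε` is a lifting radius: the `g^K`-image of the `ε`-ball about `x_K` lifts
to `X^u(x, β/2)`. -/
def IsLiftingRadius (P : Set S.Solenoid) (ε : ℝ) : Prop :=
  ∀ (x : S.UnstableSpace P) (w : Y), dist w (x.1.1 S.K) < ε →
    ∃ v ∈ unstableNhd x (S.β / 2), π₀ v = S.g^[S.K] w

theorem IsLiftingRadius.mem_image {ε : ℝ} (hε : IsLiftingRadius P ε) {x z : S.UnstableSpace P}
    (h : dist (z.1.1 S.K) (x.1.1 S.K) < ε) : π₀ z ∈ π₀ '' unstableNhd x (S.β / 2) := by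
  obtain ⟨v, hv, hvz⟩ := hε x _ h
  exact ⟨v, hv, hvz.trans (iterate_coord_K z)⟩

/-- Points u near z still have u_K within ε of x_K, so π₀ u = g^K(u_K) lifts to X^u(x, β/2). -/
theorem IsLiftingRadius.germ_le {ε : ℝ} (hε : IsLiftingRadius P ε) {x z : S.UnstableSpace P}
    (h0 : π₀ x = π₀ z) (h : dist (z.1.1 S.K) (x.1.1 S.K) < ε) : germ z ≤ germ x := by
  rw [germ_eq_nhdsWithin_unstableNhd x, h0]
  refine le_inf (germ_le_nhds z) (le_principal_iff.2 ?_)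
  have h1 : ∀ᶠ u in 𝓝 z, dist (u.1.1 S.K) (x.1.1 S.K) < ε :=
    ((continuous_coord S.K).dist continuous_const).continuousAt.eventually (gt_mem_nhds h)
  exact mem_map.2 (h1.mono fun u hu => hε.mem_image hu)

theorem IsLiftingRadius.germ_eq {ε : ℝ} (hε : IsLiftingRadius P ε) {x z : S.UnstableSpace P}
    (h0 : π₀ x = π₀ z) (h : dist (z.1.1 S.K) (x.1.1 S.K) < ε) : germ z = germ x :=
  le_antisymm (hε.germ_le h0 h) (hε.germ_le h0.symm (by rwa [dist_comm]))

theorem exists_finite_net_fibre (P : Set S.Solenoid) (y : Y) {ε : ℝ} (hε : 0 < ε) :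
    ∃ T : Set (S.UnstableSpace P), T.Finite ∧ (∀ t ∈ T, π₀ t = y) ∧
      ∀ x : S.UnstableSpace P, π₀ x = y → ∃ t ∈ T, dist (x.1.1 S.K) (t.1.1 S.K) < ε := by
  set f : S.UnstableSpace P → Y := fun x => x.1.1 S.K
  obtain ⟨A, hA, hAf, hcov⟩ := Metric.finite_approx_of_totallyBounded
    (TotallyBounded.subset (subset_univ (f '' (π₀ ⁻¹' {y}))) isCompact_univ.totallyBounded) ε hε
  obtain ⟨T, hT, hTf, rfl⟩ := exists_subset_image_finite_and.1 ⟨A, hA, hAf, rfl⟩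
  refine ⟨T, hTf, fun t ht => hT ht, fun x hx => ?_⟩
  simpa using hcov (mem_image_of_mem f hx)

/-- Near `y`, the sets `π₀ (X^u(x, β/2))` and `π₀ (X^u(x', β/2))` agree, uniformly over the pairs
of points `x`, `x'` of the fibre of `y` with the same germ. -/
theorem eventually_mem_image_of_germ_eq (P : Set S.Solenoid) (y : Y) :
    ∀ᶠ s in 𝓝 y, ∀ x x' : S.UnstableSpace P, π₀ x = y → germ x = germ x' →
      s ∈ π₀ '' unstableNhd x (S.β / 2) → s ∈ π₀ '' unstableNhd x' (S.β / 2) := by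
  have hβ := half_pos S.β_pos
  obtain ⟨ε, hε, hlift⟩ := exists_lift_unstableNhd P hβ (half_le_self S.β_pos.le)
  replace hlift : IsLiftingRadius P ε := hlift
  obtain ⟨T, hTf, hTy, hT⟩ := exists_finite_net_fibre P y (half_pos hε)
  obtain ⟨η, hη, hclose⟩ := S.exists_mem_localUnstable_of_dist_zero_lt (half_pos hε)
  -- Only finitely many pairs from the net are compared. The target radius ε/2 leaves room to pass
  -- from t' to any x' whose coordinate K is within ε/2 of that of t'.
  have h1 : ∀ᶠ s in 𝓝 y, ∀ t ∈ T, ∀ t' ∈ T, germ t = germ t' →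
      s ∈ π₀ '' unstableNhd t (S.β / 2) → s ∈ π₀ '' unstableNhd t' (ε / 2) := by
    refine (eventually_all_finite hTf).2 fun t ht => (eventually_all_finite hTf).2 fun t' _ => ?_
    rw [eventually_imp_distrib_left]
    intro htt'
    have h2 : π₀ '' unstableNhd t' (ε / 2) ∈ germ t :=
      htt' ▸ image_mem_germ (unstableNhd_mem_nhds t' (half_pos hε))
    rw [germ_eq_nhdsWithin_unstableNhd t, hTy t ht] at h2
    exact eventually_nhdsWithin_iff.1 h2
  filter_upwards [h1, Metric.ball_mem_nhds y hη] with s hs hsy x x' hx hxx'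
  rintro ⟨z, hz, rfl⟩
  have hx' : π₀ x' = y := (π₀_eq_of_germ_eq hxx').symm.trans hx
  have hzx : z ∈ unstableNhd x (ε / 2) := hclose x.1 z.1
    (fun n => ((hz.1 n).trans (half_lt_self S.β_pos)).le) (by
      rw [dist_comm]; exact lt_of_eq_of_lt (congrArg _ hx) hsy)
  obtain ⟨t, ht, hxt⟩ := hT x hx
  obtain ⟨t', ht', hxt'⟩ := hT x' hx'
  have hzt : π₀ z ∈ π₀ '' unstableNhd t (S.β / 2) := hlift.mem_image (by
    linarith [dist_triangle_left (z.1.1 S.K) (t.1.1 S.K) (x.1.1 S.K), hzx.1 S.K])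
  have htt' : germ t = germ t' := by
    rw [← hlift.germ_eq ((hTy t ht).trans hx.symm) (by linarith : dist _ _ < ε), hxx',
      hlift.germ_eq ((hTy t' ht').trans hx'.symm) (by linarith : dist _ _ < ε)]
  obtain ⟨u, hu, huz⟩ := hs t ht t' ht' htt' hzt
  rw [← huz]
  exact hlift.mem_image (by
    linarith [dist_triangle_left (u.1.1 S.K) (x'.1.1 S.K) (t'.1.1 S.K), hu.1 S.K,
      dist_comm (x'.1.1 S.K) (t'.1.1 S.K)])

/-- Points over a neighbourhood of `y` are in `X^u(x, β/2)` for some `x` over `y`. -/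
theorem eventually_exists_mem_unstableNhd (P : Set S.Solenoid) (y : Y) :
    ∀ᶠ s in 𝓝 y, ∀ z : S.UnstableSpace P, π₀ z = s →
      ∃ x, π₀ x = y ∧ z ∈ unstableNhd x (S.β / 2) := by
  obtain ⟨ε, hε, hlift⟩ := exists_lift_unstableNhd P (half_pos S.β_pos) (half_le_self S.β_pos.le)
  have hc : Continuous S.g^[S.K] := S.continuous_g.iterate _
  -- As g^K is a closed map, its fibres over points near y lie within ε of its fibre over y; a point
  -- of the latter is then lifted to X^u(z, β/2).
  have h1 := hc.isClosedMap.eventually_nhds_fiber (p := fun w => ∃ w', S.g^[S.K] w' = y ∧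
    dist w' w < ε) y fun w hw => by
      filter_upwards [Metric.ball_mem_nhds w hε] with w' hw'
      exact ⟨w, hw, by rw [dist_comm]; exact hw'⟩
  filter_upwards [h1] with s hs z hz
  obtain ⟨w', hw'y, hw'⟩ := hs (z.1.1 S.K) ((iterate_coord_K z).trans hz)
  obtain ⟨x, hx, hxw⟩ := hlift z w' hw'
  exact ⟨x, hxw.trans hw'y, mem_unstableNhd_comm.1 hx⟩

theorem finite_fibre_r (P : Set S.Solenoid) {εY : ℝ} (hε : 0 < εY) (hε' : εY ≤ S.β / 2) (y : Y) :
    (r P εY ⁻¹' {y}).Finite := by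
  obtain ⟨ε, hε0, hlift⟩ := exists_lift_unstableNhd P (half_pos S.β_pos) (half_le_self S.β_pos.le)
  replace hlift : IsLiftingRadius P ε := hlift
  obtain ⟨T, hTf, hTy, hT⟩ := exists_finite_net_fibre P y hε0
  refine (hTf.image (q P εY)).subset fun ρ hρ => ?_
  obtain ⟨x, rfl⟩ := surjective_q P εY ρ
  have hx : π₀ x = y := hρ
  obtain ⟨t, ht, hxt⟩ := hT x hx
  exact ⟨t, ht, (q_eq_iff hε hε').2 (hlift.germ_eq ((hTy t ht).trans hx.symm) hxt).symm⟩

end fibre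

end WielerSystem

/-- The covering argument is local on `Y`: it uses only Wieler's axioms and the bounds
`0 < εY < β / 4`, so mixing and the finiteness and invariance of `P` are not needed. -/
theorem mainTheorem10 {Y : Type*} [MetricSpace Y] [CompactSpace Y]
    (S : WielerSystem Y) (hmix : S.IsMixing)
    (P : Set S.Solenoid) (hPfin : P.Finite) (hPinv : Set.MapsTo S.shift P P)
    (K₀ : ℕ) (hK₀ : S.IsAdmissibleDepth K₀)
    (εY : ℝ) (hεY : S.IsAdmissibleRadius K₀ εY)
    (y : Y) :
    (WielerSystem.r P εY ⁻¹' {y}).Finite ∧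
    ∃ (W : Set Y)
      (U : ↥(WielerSystem.r P εY ⁻¹' {y}) → Set (WielerSystem.QuotientSpace P εY))
      (V : ↥((WielerSystem.π₀ : S.UnstableSpace P → Y) ⁻¹' {y}) → Set (S.UnstableSpace P)),
      IsOpen W ∧ y ∈ W ∧
      (∀ ρ, IsOpen (U ρ) ∧ ρ.1 ∈ U ρ) ∧
      (∀ x, IsOpen (V x)) ∧
      (∀ x x', x ≠ x' → Disjoint (V x) (V x')) ∧
      WielerSystem.r P εY ⁻¹' W = ⋃ ρ, U ρ ∧
      (∀ x, x.1 ∈ V x) ∧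
      (WielerSystem.π₀ : S.UnstableSpace P → Y) ⁻¹' W = ⋃ x, V x ∧
      (∀ x, Topology.IsEmbedding (fun z : ↥(V x) => WielerSystem.q P εY z.1) ∧
        WielerSystem.q P εY '' V x = U ⟨WielerSystem.q P εY x.1, x.2⟩) := by
  open WielerSystem in
  obtain ⟨hε, hε4, -⟩ := hεY
  have hβ := half_pos S.β_pos
  have hε' : εY ≤ S.β / 2 := by linarith [S.β_pos]
  refine ⟨finite_fibre_r P hε hε' y, ?_⟩
  obtain ⟨W, hW, hWo, hyW⟩ := eventually_nhds_iff.1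
    ((eventually_mem_image_of_germ_eq P y).and (eventually_exists_mem_unstableNhd P y))
  set V : ↥((π₀ : S.UnstableSpace P → Y) ⁻¹' {y}) → Set (S.UnstableSpace P) :=
    fun x => unstableNhd x.1 (S.β / 2) ∩ π₀ ⁻¹' W with hV
  have hVo (x) : IsOpen (V x) :=
    (isOpen_unstableNhd x.1 (half_le_self S.β_pos.le)).inter (hWo.preimage continuous_π₀)
  have hVs (x) : IsUnstablySmall (V x) :=
    (isUnstablySmall_unstableNhd x.1 le_rfl).mono inter_subset_left
  have hxV (x) : x.1 ∈ V x := by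
    refine ⟨mem_unstableNhd_self x.1 hβ, ?_⟩
    have hx : π₀ x.1 = y := x.2
    rwa [mem_preimage, hx]
  have hVW : (π₀ : S.UnstableSpace P → Y) ⁻¹' W = ⋃ x, V x := by
    ext z
    refine ⟨fun hz => ?_, fun hz => ?_⟩
    · obtain ⟨x, hx, hzx⟩ := (hW _ hz).2 z rfl
      exact mem_iUnion.2 ⟨⟨x, hx⟩, hzx, hz⟩
    · obtain ⟨x, hx⟩ := mem_iUnion.1 hz
      exact hx.2
  have hVq (x x') (h : q P εY x.1 = q P εY x'.1) : q P εY '' V x ⊆ q P εY '' V x' := by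
    rw [q_eq_iff hε hε'] at h
    have himage : π₀ '' V x = π₀ '' V x' := by
      have hx : π₀ x.1 = y := x.2
      have hx' : π₀ x'.1 = y := x'.2
      rw [hV, image_inter_preimage, image_inter_preimage]
      ext s
      exact and_congr_left fun hs => ⟨(hW s hs).1 _ _ hx h, (hW s hs).1 _ _ hx' h.symm⟩
    rintro _ ⟨z, hz, rfl⟩
    obtain ⟨z', hz', hzz'⟩ : π₀ z ∈ π₀ '' V x' := himage ▸ mem_image_of_mem _ hz
    refine ⟨z', hz', (q_eq_iff hε hε').2 ?_⟩
    rw [germ_eq_nhdsWithin (hVs x) (hVo x) hz, germ_eq_nhdsWithin (hVs x') (hVo x') hz', himage,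
      hzz']
  -- The union over all x in the class ρ avoids choosing a representative; by `hVq` its members
  -- coincide.
  refine ⟨W, fun ρ => ⋃ x, ⋃ _ : q P εY x.1 = ρ.1, q P εY '' V x, V, hWo, hyW, fun ρ => ⟨?_, ?_⟩,
    hVo, fun x x' hne => ?_, ?_, hxV, hVW,
    fun x => ⟨isEmbedding_q_restrict hε hε' (hVs x) (hVo x), ?_⟩⟩
  · exact isOpen_iUnion fun x => isOpen_iUnion fun _ => isOpenMap_q P hε hε' _ (hVo x)
  · obtain ⟨ρ, hρ⟩ := ρ
    obtain ⟨x, rfl⟩ := surjective_q P εY ρ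
    exact mem_iUnion₂.2 ⟨⟨x, hρ⟩, rfl, mem_image_of_mem _ (hxV ⟨x, hρ⟩)⟩
  -- A common point z would put x and x' in X^u(z, β/2), where π₀ is injective.
  · refine disjoint_left.2 fun z hz hz' => hne (Subtype.ext ?_)
    have hx : x.1 ∈ unstableNhd z (S.β / 2) := mem_unstableNhd_comm.1 hz.1
    have hx' : x'.1 ∈ unstableNhd z (S.β / 2) := mem_unstableNhd_comm.1 hz'.1
    exact (isUnstablySmall_unstableNhd z le_rfl).injOn hx hx' (Eq.trans x.2 (Eq.symm x'.2))
  · ext σ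
    obtain ⟨z, rfl⟩ := surjective_q P εY σ
    refine ⟨fun hz => ?_, fun hz => ?_⟩
    · obtain ⟨x, hzx⟩ := mem_iUnion.1 (hVW.subset hz)
      exact mem_iUnion.2 ⟨⟨q P εY x.1, x.2⟩, mem_iUnion₂.2 ⟨x, rfl, mem_image_of_mem _ hzx⟩⟩
    · obtain ⟨ρ, hρ⟩ := mem_iUnion.1 hz
      obtain ⟨x, -, u, hu, huz⟩ := mem_iUnion₂.1 hρ
      rw [← huz]
      exact hu.2
  · refine Subset.antisymm (fun σ hσ => mem_iUnion₂.2 ⟨x, rfl, hσ⟩) ?_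
    exact iUnion₂_subset fun x' hx' => hVq x' x hx'
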